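/- **Theorem 3.2.** Let $p_1<p_2$ be real numbers and $\mu\in(0,1)$. Let $u_0:\mathbb R\to\mathbb C$ be a tempered function (that is, $(1+|x|)^{-N}u_0\in L^1(\mathbb R)$ for some $N$) whose Fourier transform $\mathcal F u_0$ (in the sense of tempered distributions, normalized by $\mathcal F f(p)=\int_{\mathbb R} f(x)e^{-ixp}\,dx$) is a function that vanishes outside $[p_1,p_2]$ and satisfies $$\mathcal F u_0(p)=(p-p_1)^{\mu-1}\,\tilde u(p)\quad\text{for } p\in(p_1,p_2],\qquad \mathcal F u_0(p_2)=0,$$ for some $\tilde u\in C^1([p_1,p_2],\mathbb C)$ with $\tilde u(p_1)\neq 0$. Let $\delta\in\big[\tfrac{\mu+1}{2},1\big)$ and $\varepsilon\in\big(0,\delta-\tfrac12\big)$. Put $T_{p_2}:=\big(2(p_2-p_1)\big)^{-1/\varepsilon}$ and $$\mathfrak R_\varepsilon:=\Big\{(t,x)\ :\ t>T_{p_2},\quad \frac{x}{2t}-p_1\ge t^{-\varepsilon},\quad x<2p_2t\Big\}.$$ Then there are constants $C_{\mu>1/2},\,C_{\mu=1/2},\,C_{\mu<1/2}>0$, independent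 of $t$ and $x$, such that the solution $u$ of the free Schrödinger equation $i\partial_t u+\partial_x^2u=0$ $(t>0,\ x\in\mathbb R)$ with $u(0,\cdot)=u_0$ satisfies, for all $(t,x)\in\mathfrak R_\varepsilon$: * if $\mu>\tfrac12$: $\ |u(t,x)|\le C_{\mu>1/2}\;t^{-\frac12+\varepsilon(1-\mu)}$; * if $\mu=\tfrac12$: $\ |u(t,x)|\le C_{\mu=1/2}\;t^{-\frac12+\frac{\varepsilon}{2}}$; * if $\mu<\tfrac12$: $\ |u(t,x)|\le C_{\mu<1/2}\;t^{-\mu+\varepsilon\mu}$. Here a solution is a function $u$ on $[0,\infty)\times\mathbb R$ with $u(0,\cdot)=u_0$, continuous in $x$ for each $t$, bounded by a polynomial in $|x|$ locally uniformly in $t\ge0$, such that for every Schwartz function $\varphi$ the map $t\mapsto\int_{\mathbb R} u(t,x)\varphi(x)\,dx$ is continuous at $t=0$ and has derivative $i\int_{\mathbb R} u(t,x)\varphi''(x)\,dx$ at every $t>0$. -/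

import Mathlib

open MeasureTheory Set
open scoped SchwartzMap

noncomputable section

/-- A (measurable) function on the line that defines a tempered distribution: it is integrable
against some inverse power of `1 + |x|`. -/
def IsTemperedFunction (f : ℝ → ℂ) : Prop :=
  ∃ N : ℕ, Integrable (fun x : ℝ => ((((1 + |x|) ^ N)⁻¹ : ℝ) : ℂ) * f x)

/-- The Fourier transform `φ̂ (p) = ∫ e^{-i x p} φ(x) dx` of a Schwartz function, in the
normalization for which the inversion formula carries the factor `1 / (2π)`. -/
def schwartzHat (φ : 𝓢(ℝ, ℂ)) (p : ℝ) : ℂ :=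
  ∫ x : ℝ, Complex.exp (-(Complex.I * (x : ℂ) * (p : ℂ))) * φ x

/-- `U` is the Fourier transform of `f` in the sense of tempered distributions:
`⟨f, φ̂⟩ = ⟨U, φ⟩` for all Schwartz functions `φ`. -/
def IsFourierTransform (f U : ℝ → ℂ) : Prop :=
  IsTemperedFunction f ∧ IsTemperedFunction U ∧
    ∀ φ : 𝓢(ℝ, ℂ), ∫ x : ℝ, f x * schwartzHat φ x = ∫ p : ℝ, U p * φ p

/-- The condition on the initial datum: its Fourier transform `U` vanishes off `[p₁, p₂]`, is
`(p - p₁)^(μ - 1) ũ(p)` on `(p₁, p₂]` with `ũ ∈ C¹([p₁, p₂], ℂ)`, `ũ(p₁) ≠ 0`, and `U(p₂) = 0`. -/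
def SingularBandCondition (p₁ p₂ μ : ℝ) (u₀ : ℝ → ℂ) : Prop :=
  ∃ U ũ : ℝ → ℂ,
    IsFourierTransform u₀ U ∧
    (∀ p, p ∉ Icc p₁ p₂ → U p = 0) ∧
    ContDiffOn ℝ 1 ũ (Icc p₁ p₂) ∧
    ũ p₁ ≠ 0 ∧
    (∀ p ∈ Ioc p₁ p₂, U p = (((p - p₁) ^ (μ - 1) : ℝ) : ℂ) * ũ p) ∧
    U p₂ = 0

/-- `u` is a solution of `i ∂ₜ u + ∂ₓ² u = 0` for `t > 0`, with `u(0, ·) = u₀`: a function,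
continuous in `x`, of polynomial growth in `x` locally uniformly in time, that solves the equation
in the sense of tempered distributions in `x`, namely
`d/dt ⟨u(t), φ⟩ = i ⟨u(t), φ''⟩` for all Schwartz functions `φ`. -/
structure IsFreeSchrodingerSolution (u₀ : ℝ → ℂ) (u : ℝ → ℝ → ℂ) : Prop where
  initial : ∀ x, u 0 x = u₀ x
  continuous_space : ∀ t, 0 ≤ t → Continuous (u t)
  growth : ∀ T : ℝ, ∃ (C : ℝ) (N : ℕ), ∀ t ∈ Icc 0 T, ∀ x, ‖u t x‖ ≤ C * (1 + |x|) ^ N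
  continuous_initial : ∀ φ : 𝓢(ℝ, ℂ),
    ContinuousWithinAt (fun s => ∫ x : ℝ, u s x * φ x) (Ici 0) 0
  equation : ∀ φ : 𝓢(ℝ, ℂ), ∀ t, 0 < t →
    HasDerivAt (fun s => ∫ x : ℝ, u s x * φ x)
      (Complex.I * ∫ x : ℝ, u t x * deriv (deriv φ) x) t

/-- The time `T_p = (2 (p - p₁))^(-1/ε)`. -/
def thresholdTime (ε p₁ p : ℝ) : ℝ := (2 * (p - p₁)) ^ (-(1 / ε))

/-- The space-time region `R_ε`. -/
def regionR (ε p₁ p₂ : ℝ) : Set (ℝ × ℝ) :=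
  {z | z.1 ^ (-ε) ≤ z.2 / (2 * z.1) - p₁ ∧ z.2 < 2 * p₂ * z.1 ∧ thresholdTime ε p₁ p₂ < z.1}

end

/-! The solution is an explicit oscillatory integral, and the decay is read off by splitting it
according to the distance from the singular frequency and from the stationary point.

Representation. For fixed `t` and `y`, pair `u r` with the complex heat kernel of parameter `η + i(t
- r)`. This kernel solves the adjoint equation in `r`, so the pairing is constant on `[0, t]`. At `r
= t` it is a Gaussian mollification of `u t` at `y`; at `r = 0` it is, by definition of the
distributional Fourier transform, a Gaussian-damped integral of `U` (`integral_mul_heatKernel_eq`).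
Letting `η → 0` gives `2π u(t, y) = ∫ U(p) exp(-itp² + iyp) dp` (`two_pi_mul_solution_eq`), so every
solution in the weak class is covered.

Oscillatory integral. Completing the square turns `2π|u(t, x)|` into the modulus of an integral of
`s^(μ-1) ũ(s + p₁) exp(-it(s - d)²)` over `[0, p₂ - p₁]`, with `d = x/(2t) - p₁`. Near `s = 0`
absolute values suffice; up to `d/2` the phase has no stationary point and the first derivative test
applies; beyond `d/2` the amplitude is tame and the second derivative test gives `t^(-1/2)`. The
result is a bound by `t^(-1/2) d^(μ-1) + (td)^(-μ)` (`norm_integral_rpow_mul_quadPhase_le`).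

Conclusion. Inserting `d ≥ t^(-ε)` gives the powers `-1/2 + ε(1-μ)` and `-μ + εμ`. Their difference
is `(μ - 1/2)(1 - 2ε)`, and `ε < 1/2`, so the sign of `μ - 1/2` decides which one dominates. -/

noncomputable section

open Filter Topology

/-! ### Complex Gaussians as Schwartz functions -/

section Gaussian

open Polynomial

/-- The Gaussian `x ↦ exp (-b x² + c x)` with complex parameters. -/
def gaussianExp (b c : ℂ) (x : ℝ) : ℂ := Complex.exp (-b * (x : ℂ) ^ 2 + c * x)

theorem norm_gaussianExp (b c : ℂ) (x : ℝ) :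
    ‖gaussianExp b c x‖ = Real.exp (-b.re * x ^ 2 + c.re * x) := by
  rw [gaussianExp, Complex.norm_exp]
  congr 1
  rw [← Complex.ofReal_pow]
  simp [-Complex.ofReal_pow]

theorem hasDerivAt_gaussianExp (b c : ℂ) (x : ℝ) :
    HasDerivAt (gaussianExp b c) ((-2 * b * x + c) * gaussianExp b c x) x := by
  have h1 : HasDerivAt (fun x : ℝ => (x : ℂ)) 1 x := Complex.ofRealCLM.hasDerivAt
  have h := (((h1.pow 2).const_mul (-b)).add (h1.const_mul c)).cexp
  refine HasDerivAt.congr_deriv (f := gaussianExp b c) h ?_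
  simp [gaussianExp]
  ring

theorem iteratedDeriv_gaussianExp (b c : ℂ) (n : ℕ) :
    ∃ P : ℂ[X], ∀ x : ℝ,
      iteratedDeriv n (gaussianExp b c) x = P.eval (x : ℂ) * gaussianExp b c x := by
  induction n with
  | zero => exact ⟨1, fun x => by simp⟩
  | succ n ih =>
    obtain ⟨P, hP⟩ := ih
    refine ⟨derivative P + P * (C (-2 * b) * X + C c), fun x => ?_⟩
    rw [iteratedDeriv_succ, funext hP]
    have h1 : HasDerivAt (fun x : ℝ => P.eval (x : ℂ)) (P.derivative.eval (x : ℂ)) x :=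
      (P.hasDerivAt (x : ℂ)).comp_ofReal
    refine (h1.mul (hasDerivAt_gaussianExp b c x)).deriv.trans ?_
    simp
    ring

theorem exists_bound_pow_mul_gaussianExp {b : ℂ} (hb : 0 < b.re) (c : ℂ) (k : ℕ) :
    ∃ C : ℝ, ∀ x : ℝ, |x| ^ k * ‖gaussianExp b c x‖ ≤ C := by
  -- The power is absorbed into `k! exp |x|`; the exponent here is the maximum over `s` of `(|Re c|
  -- + 1) s - (Re b) s²`.
  refine ⟨k.factorial * Real.exp ((|c.re| + 1) ^ 2 / (4 * b.re)), fun x => ?_⟩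
  have h1 : |x| ^ k ≤ k.factorial * Real.exp |x| := by
    have := Real.pow_div_factorial_le_exp |x| (abs_nonneg x) k
    rw [div_le_iff₀ (by positivity)] at this
    linarith
  rw [norm_gaussianExp]
  calc |x| ^ k * Real.exp (-b.re * x ^ 2 + c.re * x)
      ≤ (k.factorial * Real.exp |x|) * Real.exp (-b.re * x ^ 2 + c.re * x) := by gcongr
    _ = k.factorial * Real.exp (|x| + (-b.re * x ^ 2 + c.re * x)) := by
      rw [Real.exp_add |x|]; ring
    _ ≤ _ := by
      gcongr
      rw [le_div_iff₀ (by positivity)]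
      have h2 : c.re * x ≤ |c.re| * |x| := by rw [← abs_mul]; exact le_abs_self _
      have h3 : x ^ 2 = |x| ^ 2 := (sq_abs x).symm
      rw [h3]
      nlinarith [sq_nonneg (2 * b.re * |x| - (|c.re| + 1))]

theorem exists_bound_polynomial_mul_gaussianExp {b : ℂ} (hb : 0 < b.re) (c : ℂ) (P : ℂ[X])
    (k : ℕ) :
    ∃ C : ℝ, ∀ x : ℝ, |x| ^ k * ‖P.eval (x : ℂ) * gaussianExp b c x‖ ≤ C := by
  induction P using Polynomial.induction_on' with
  | add p q hp hq =>
    obtain ⟨C₁, h₁⟩ := hp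
    obtain ⟨C₂, h₂⟩ := hq
    refine ⟨C₁ + C₂, fun x => ?_⟩
    rw [eval_add, add_mul]
    calc _ ≤ |x| ^ k * (‖p.eval (x : ℂ) * gaussianExp b c x‖
          + ‖q.eval (x : ℂ) * gaussianExp b c x‖) := by gcongr; exact norm_add_le _ _
      _ ≤ _ := by rw [mul_add]; exact add_le_add (h₁ x) (h₂ x)
  | monomial n a =>
    obtain ⟨C, hC⟩ := exists_bound_pow_mul_gaussianExp hb c (k + n)
    refine ⟨‖a‖ * C, fun x => ?_⟩
    calc _ = ‖a‖ * (|x| ^ (k + n) * ‖gaussianExp b c x‖) := by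
          simp [eval_monomial]; ring
      _ ≤ _ := by gcongr; exact hC x

theorem contDiff_gaussianExp (b c : ℂ) (n : WithTop ℕ∞) : ContDiff ℝ n (gaussianExp b c) := by
  unfold gaussianExp
  have : ContDiff ℝ n (fun x : ℝ => (x : ℂ)) := Complex.ofRealCLM.contDiff
  exact ((contDiff_const.mul (this.pow 2)).add (contDiff_const.mul this)).cexp

/-- The complex Gaussian `exp (-b x² + c x)`, `0 < Re b`, as a Schwartz function. -/
def gaussianSchwartz (b c : ℂ) (hb : 0 < b.re) : 𝓢(ℝ, ℂ) where
  toFun := gaussianExp b c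
  smooth' := contDiff_gaussianExp b c _
  decay' k n := by
    obtain ⟨P, hP⟩ := iteratedDeriv_gaussianExp b c n
    obtain ⟨C, hC⟩ := exists_bound_polynomial_mul_gaussianExp hb c P k
    refine ⟨C, fun x => ?_⟩
    rw [norm_iteratedFDeriv_eq_norm_iteratedDeriv, hP, Real.norm_eq_abs]
    exact hC x

@[simp] theorem gaussianSchwartz_apply (b c : ℂ) (hb : 0 < b.re) (x : ℝ) :
    gaussianSchwartz b c hb x = gaussianExp b c x := rfl

end Gaussian

theorem SchwartzMap.integrable_one_add_pow_mul (φ : 𝓢(ℝ, ℂ)) (k : ℕ) :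
    Integrable (fun x : ℝ => (1 + |x|) ^ k * ‖φ x‖) := by
  have h := ((φ.integrable_pow_mul volume 0).add (φ.integrable_pow_mul volume k)).const_mul
    (2 ^ (k - 1) : ℝ)
  refine h.mono' (by have := φ.continuous; fun_prop) (Eventually.of_forall fun x => ?_)
  rw [Real.norm_of_nonneg (by positivity)]
  simp only [Pi.add_apply, pow_zero, one_mul, Real.norm_eq_abs]
  have := add_pow_le (zero_le_one) (abs_nonneg x) k
  calc _ ≤ (2 ^ (k - 1) * (1 ^ k + |x| ^ k)) * ‖φ x‖ := by gcongr
    _ = _ := by ring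

/-! ### The heat kernel with complex time -/

/-- The kernel `(π / z)^(1/2) exp (-(x - y)² / (4 z))`, the Fourier transform of
`p ↦ exp (-z p² + i y p)`. -/
def heatKernel (z : ℂ) (y x : ℝ) : ℂ :=
  (Real.pi / z) ^ (1 / 2 : ℂ) * Complex.exp (-((x : ℂ) - y) ^ 2 / (4 * z))

theorem re_inv_pos {z : ℂ} (hz : 0 < z.re) : 0 < (z⁻¹).re := by
  rw [Complex.inv_re]
  have : z ≠ 0 := by rintro rfl; simp at hz
  exact div_pos hz (Complex.normSq_pos.2 this)

theorem ne_zero_of_re_pos {z : ℂ} (hz : 0 < z.re) : z ≠ 0 := by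
  rintro rfl; simp at hz

/-- The kernel `heatKernel z y` as a Schwartz function. -/
def heatSchwartz (z : ℂ) (hz : 0 < z.re) (y : ℝ) : 𝓢(ℝ, ℂ) :=
  ((Real.pi / z) ^ (1 / 2 : ℂ) * Complex.exp (-(y : ℂ) ^ 2 / (4 * z))) •
    gaussianSchwartz ((1 / 4 : ℝ) * z⁻¹) (y / (2 * z)) (by
      rw [Complex.re_ofReal_mul]; exact mul_pos (by norm_num) (re_inv_pos hz))

theorem heatSchwartz_apply {z : ℂ} (hz : 0 < z.re) (y x : ℝ) :
    heatSchwartz z hz y x = heatKernel z y x := by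
  have := ne_zero_of_re_pos hz
  simp only [heatSchwartz, smul_apply, gaussianSchwartz_apply, gaussianExp, heatKernel,
    smul_eq_mul]
  rw [mul_assoc, ← Complex.exp_add]
  congr 2
  push_cast
  field_simp
  ring

theorem hasDerivAt_heatKernel_param {z : ℂ} (hz : 0 < z.re) (y x : ℝ) :
    HasDerivAt (fun z => heatKernel z y x)
      ((-(1 / (2 * z)) + ((x : ℂ) - y) ^ 2 / (4 * z ^ 2)) * heatKernel z y x) z := by
  have h0 := ne_zero_of_re_pos hz
  -- `π/z` stays in the right half-plane, so the principal square root is holomorphic there.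
  have hs : (Real.pi / z : ℂ) ∈ Complex.slitPlane := by
    left
    rw [div_eq_mul_inv, Complex.re_ofReal_mul]
    exact mul_pos Real.pi_pos (re_inv_pos hz)
  have hp : (Real.pi : ℂ) ≠ 0 := by exact_mod_cast Real.pi_ne_zero
  have hw : (Real.pi / z : ℂ) ≠ 0 := div_ne_zero hp h0
  have h1 : HasDerivAt (fun z : ℂ => (Real.pi / z : ℂ)) (-Real.pi / z ^ 2) z := by
    simpa [div_eq_mul_inv] using (hasDerivAt_inv h0).const_mul (Real.pi : ℂ)
  have h2 := h1.cpow_const (c := (1 / 2 : ℂ)) hs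
  have h3 : HasDerivAt (fun z : ℂ => -((x : ℂ) - y) ^ 2 / (4 * z))
      (((x : ℂ) - y) ^ 2 / (4 * z ^ 2)) z := by
    have := (hasDerivAt_inv h0).const_mul (-((x : ℂ) - y) ^ 2 / 4)
    refine (this.congr_deriv ?_).congr_of_eventuallyEq (Eventually.of_forall fun w => ?_)
    · field_simp
    · simp only [div_eq_mul_inv, mul_inv]; ring
  have h := h2.mul h3.cexp
  refine HasDerivAt.congr_deriv (f := fun z => heatKernel z y x) h ?_
  rw [Complex.cpow_sub _ _ hw, Complex.cpow_one, heatKernel]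
  field_simp

theorem hasDerivAt_heatKernel_space (z : ℂ) (y x : ℝ) :
    HasDerivAt (fun x => heatKernel z y x) (-((x : ℂ) - y) / (2 * z) * heatKernel z y x) x := by
  have h1 : HasDerivAt (fun x : ℝ => (x : ℂ)) 1 x := Complex.ofRealCLM.hasDerivAt
  have h := ((((h1.sub_const (y : ℂ)).pow 2).neg.div_const (4 * z)).cexp).const_mul
    ((Real.pi / z) ^ (1 / 2 : ℂ))
  refine HasDerivAt.congr_deriv (f := fun x => heatKernel z y x) h ?_
  simp [heatKernel]
  ring

/-- The factor is the one in `hasDerivAt_heatKernel_param`: the kernel solves the heat equation in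
the complex variable `z`, which makes it an adjoint Schrödinger solution when `z` moves parallel to
the imaginary axis. -/
theorem deriv_deriv_heatKernel {z : ℂ} (hz : 0 < z.re) (y x : ℝ) :
    deriv (deriv (heatKernel z y)) x =
      (-(1 / (2 * z)) + ((x : ℂ) - y) ^ 2 / (4 * z ^ 2)) * heatKernel z y x := by
  have h0 := ne_zero_of_re_pos hz
  have h1 : HasDerivAt (fun x : ℝ => (x : ℂ)) 1 x := Complex.ofRealCLM.hasDerivAt
  have hd : deriv (heatKernel z y) = fun x : ℝ => -((x : ℂ) - y) / (2 * z) * heatKernel z y x :=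
    funext fun x => (hasDerivAt_heatKernel_space z y x).deriv
  rw [hd]
  have h := (((h1.sub_const (y : ℂ)).neg.div_const (2 * z))).mul
    (hasDerivAt_heatKernel_space z y x)
  refine h.deriv.trans ?_
  simp only [Pi.neg_apply]
  field_simp
  ring

theorem schwartzHat_gaussianSchwartz {z : ℂ} (hz : 0 < z.re) (y x : ℝ) :
    schwartzHat (gaussianSchwartz z (Complex.I * y) hz) x = heatKernel z y x := by
  have h := fourierIntegral_gaussian hz ((y : ℂ) - x)
  rw [heatKernel, schwartzHat]
  have e : -((x : ℂ) - y) ^ 2 / (4 * z) = -((y : ℂ) - x) ^ 2 / (4 * z) := by ring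
  rw [e, ← h]
  congr 1 with p
  rw [gaussianSchwartz_apply, gaussianExp, ← Complex.exp_add, ← Complex.exp_add]
  congr 1
  ring

/-- The second derivatives of the heat kernels are dominated by a rapidly decreasing function,
uniformly for `z` bounded and bounded away from the imaginary axis. -/
theorem exists_deriv_deriv_heatKernel_bound {m R : ℝ} (hm : 0 < m) (hR : 0 < R) (y : ℝ) :
    ∃ (K : ℝ) (φ : 𝓢(ℝ, ℂ)), ∀ z : ℂ, m ≤ z.re → ‖z‖ ≤ R → ∀ x : ℝ,
      ‖deriv (deriv (heatKernel z y)) x‖ ≤ K * ((1 + |x|) ^ 2 * ‖φ x‖) := by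
  -- A uniform Gaussian rate: `Re (1/z) = Re z / |z|² ≥ m / R²`, and the kernel carries a further
  -- factor `1/4`.
  set b : ℝ := m / (4 * R ^ 2) with hb
  have hb0 : 0 < b := by positivity
  set A : ℝ := (Real.pi / m) ^ (1 / 2 : ℝ) with hA
  set B : ℝ := (1 / (2 * m) + 1 / (4 * m ^ 2)) * (1 + |y|) ^ 2 with hB
  have hA0 : 0 ≤ A := by positivity
  have hB0 : 0 ≤ B := by positivity
  let φ : 𝓢(ℝ, ℂ) := SchwartzMap.compSubConstCLM ℂ y (gaussianSchwartz b 0 (by simpa using hb0))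
  have hφ : ∀ x, ‖φ x‖ = Real.exp (-b * (x - y) ^ 2) := fun x => by
    simp only [φ, SchwartzMap.compSubConstCLM_apply, gaussianSchwartz_apply, norm_gaussianExp]
    simp
  refine ⟨A * B, φ, fun z hz hzR x => ?_⟩
  have hz0 : 0 < z.re := hm.trans_le hz
  have hne := ne_zero_of_re_pos hz0
  have hnz : m ≤ ‖z‖ := hz.trans ((le_abs_self _).trans (Complex.abs_re_le_norm z))
  have hn0 : 0 < ‖z‖ := hm.trans_le hnz
  have h1 : ‖heatKernel z y x‖ ≤ A * ‖φ x‖ := by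
    rw [heatKernel, norm_mul, hφ]
    refine mul_le_mul ?_ ?_ (norm_nonneg _) hA0
    · have : (1 / 2 : ℂ) = ((1 / 2 : ℝ) : ℂ) := by push_cast; rfl
      rw [this, Complex.norm_cpow_real, norm_div, Complex.norm_real,
        Real.norm_of_nonneg Real.pi_pos.le]
      exact Real.rpow_le_rpow (by positivity)
        (div_le_div_of_nonneg_left Real.pi_pos.le hm hnz) (by norm_num)
    · rw [Complex.norm_exp]
      have : -((x : ℂ) - y) ^ 2 / (4 * z) = ((-(x - y) ^ 2 / 4 : ℝ) : ℂ) * z⁻¹ := by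
        push_cast; field_simp
      rw [this, Complex.re_ofReal_mul, Complex.inv_re, Complex.normSq_eq_norm_sq]
      have h2 : m / R ^ 2 ≤ z.re / ‖z‖ ^ 2 := by gcongr
      apply Real.exp_le_exp.2
      have h3 : b = m / R ^ 2 / 4 := by rw [hb]; field_simp
      rw [h3]
      nlinarith [sq_nonneg (x - y)]
  have hxy : |x - y| ≤ (1 + |y|) * (1 + |x|) := by
    have := abs_sub x y
    nlinarith [abs_nonneg x, abs_nonneg y, mul_nonneg (abs_nonneg x) (abs_nonneg y)]
  have hxy1 : 1 ≤ (1 + |y|) * (1 + |x|) := by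
    nlinarith [abs_nonneg x, abs_nonneg y, mul_nonneg (abs_nonneg x) (abs_nonneg y)]
  rw [deriv_deriv_heatKernel hz0, norm_mul]
  have h2 : ‖-(1 / (2 * z)) + ((x : ℂ) - y) ^ 2 / (4 * z ^ 2)‖ ≤ B * (1 + |x|) ^ 2 := by
    calc _ ≤ 1 / (2 * ‖z‖) + |x - y| ^ 2 / (4 * ‖z‖ ^ 2) := by
          refine (norm_add_le _ _).trans (le_of_eq ?_)
          rw [norm_neg, norm_div, norm_div, norm_mul, norm_mul, norm_pow, norm_pow,
            ← Complex.ofReal_sub, Complex.norm_real, Real.norm_eq_abs]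
          simp
      _ ≤ ((1 + |y|) * (1 + |x|)) ^ 2 / (2 * m)
            + ((1 + |y|) * (1 + |x|)) ^ 2 / (4 * m ^ 2) := by
          gcongr
          nlinarith
      _ = _ := by rw [hB]; ring
  calc _ ≤ (B * (1 + |x|) ^ 2) * (A * ‖φ x‖) := by gcongr
    _ = _ := by ring

theorem integrable_mul_of_growth {v f : ℝ → ℂ} {C : ℝ} {N : ℕ} (hv : Continuous v)
    (hC : ∀ x, ‖v x‖ ≤ C * (1 + |x|) ^ N) (hf : Continuous f)
    (hi : Integrable (fun x : ℝ => (1 + |x|) ^ N * ‖f x‖)) :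
    Integrable (fun x => v x * f x) := by
  refine (hi.const_mul C).mono' (hv.mul hf).aestronglyMeasurable (Eventually.of_forall fun x => ?_)
  rw [norm_mul, ← mul_assoc]
  exact mul_le_mul_of_nonneg_right (hC x) (norm_nonneg _)

/-! ### Pairing a weakly evolving function with moving test functions -/

section Pairing

variable {u ψ ψ' : ℝ → ℝ → ℂ} {a b s C : ℝ} {N : ℕ} {B : ℝ → ℝ}

theorem norm_sub_le_of_param_deriv_bound
    (hψ : ∀ r ∈ Icc a b, ∀ x, HasDerivAt (fun r => ψ r x) (ψ' r x) r)
    (hB : ∀ r ∈ Icc a b, ∀ x, ‖ψ' r x‖ ≤ B x) (hs : s ∈ Icc a b) {r : ℝ} (hr : r ∈ Icc a b)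
    (x : ℝ) : ‖ψ r x - ψ s x‖ ≤ B x * ‖r - s‖ :=
  (convex_Icc a b).norm_image_sub_le_of_norm_hasDerivWithin_le
    (fun r hr => (hψ r hr x).hasDerivWithinAt) (fun r hr => hB r hr x) hs hr

/-- The product rule for the pairing of a weakly differentiable family of functions of polynomial
growth with a family of test functions. -/
theorem hasDerivAt_integral_mul (hs : s ∈ Ioo a b)
    (hu : ∀ r ∈ Icc a b, Continuous (u r))
    (hC : ∀ r ∈ Icc a b, ∀ x, ‖u r x‖ ≤ C * (1 + |x|) ^ N)
    (hψc : ∀ r ∈ Icc a b, Continuous (ψ r)) (hψc' : Continuous (ψ' s))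
    (hψ : ∀ r ∈ Icc a b, ∀ x, HasDerivAt (fun r => ψ r x) (ψ' r x) r)
    (hψi : ∀ r ∈ Icc a b, Integrable (fun x : ℝ => (1 + |x|) ^ N * ‖ψ r x‖))
    (hB : ∀ r ∈ Icc a b, ∀ x, ‖ψ' r x‖ ≤ B x)
    (hBi : Integrable (fun x : ℝ => (1 + |x|) ^ N * B x)) {D : ℂ}
    (hD : HasDerivAt (fun r => ∫ x, u r x * ψ s x) D s)
    (hcont : ContinuousAt (fun r => ∫ x, u r x * ψ' s x) s) :
    HasDerivAt (fun r => ∫ x, u r x * ψ r x) (D + ∫ x, u s x * ψ' s x) s := by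
  have hs' := Ioo_subset_Icc_self hs
  have hnear : ∀ᶠ r in 𝓝[≠] s, r ∈ Icc a b := nhdsWithin_le_nhds (Icc_mem_nhds hs.1 hs.2)
  have hne : ∀ᶠ r in 𝓝[≠] s, r ≠ s := self_mem_nhdsWithin
  have hi' : Integrable (fun x : ℝ => (1 + |x|) ^ N * ‖ψ' s x‖) := by
    refine hBi.mono' (by fun_prop) (Eventually.of_forall fun x => ?_)
    rw [Real.norm_of_nonneg (by positivity)]
    gcongr
    exact hB s hs' x
  -- The quotient is split into the one with `ψ s` frozen, the term `∫ u r * ψ' s`, and this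
  -- remainder. Continuity of `r ↦ u r x` is not available, so only the polynomial bound on `u r`
  -- enters here; weak continuity handles the middle term.
  have hrem : Tendsto (fun r => ∫ x, u r x * (slope (fun r => ψ r x) s r - ψ' s x)) (𝓝[≠] s)
      (𝓝 0) := by
    rw [← integral_zero ℝ ℂ (μ := volume)]
    refine tendsto_integral_filter_of_dominated_convergence
      (fun x => C * 2 * ((1 + |x|) ^ N * B x)) ?_ ?_ (hBi.const_mul _) ?_
    · filter_upwards [hnear] with r hr
      refine ((hu r hr).mul ?_).aestronglyMeasurable
      simp only [slope, vsub_eq_sub]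
      exact (((hψc r hr).sub (hψc s hs')).const_smul _).sub hψc'
    · filter_upwards [hnear, hne] with r hr hrs
      refine Eventually.of_forall fun x => ?_
      have h1 : ‖slope (fun r => ψ r x) s r‖ ≤ B x := by
        rw [slope_def_module, norm_smul, norm_inv]
        have := norm_sub_le_of_param_deriv_bound hψ hB hs' hr x
        have hpos : 0 < ‖r - s‖ := norm_pos_iff.2 (sub_ne_zero.2 hrs)
        rw [inv_mul_le_iff₀ hpos]
        linarith
      have h2 : ‖slope (fun r => ψ r x) s r - ψ' s x‖ ≤ 2 * B x :=
        (norm_sub_le _ _).trans (by linarith [hB s hs' x])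
      rw [norm_mul]
      calc _ ≤ (C * (1 + |x|) ^ N) * (2 * B x) :=
            mul_le_mul (hC r hr x) h2 (norm_nonneg _) ((norm_nonneg _).trans (hC r hr x))
        _ = _ := by ring
    · refine Eventually.of_forall fun x => ?_
      have h1 : Tendsto (fun r => slope (fun r => ψ r x) s r - ψ' s x) (𝓝[≠] s) (𝓝 0) := by
        have := (hasDerivAt_iff_tendsto_slope.1 (hψ s hs' x)).sub_const (ψ' s x)
        rwa [sub_self] at this
      have h2 := (h1.norm.const_mul (C * (1 + |x|) ^ N))
      rw [norm_zero, mul_zero] at h2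
      refine squeeze_zero_norm' ?_ h2
      filter_upwards [hnear] with r hr
      rw [norm_mul]
      exact mul_le_mul_of_nonneg_right (hC r hr x) (norm_nonneg _)
  rw [hasDerivAt_iff_tendsto_slope] at hD ⊢
  have hlim := (hD.add (hcont.tendsto.mono_left nhdsWithin_le_nhds)).add hrem
  rw [add_zero] at hlim
  refine hlim.congr' ?_
  filter_upwards [hnear, hne] with r hr hrs
  have hint : ∀ q ∈ Icc a b, ∀ q' ∈ Icc a b, Integrable (fun x => u q x * ψ q' x) :=
    fun q hq q' hq' => integrable_mul_of_growth (hu q hq) (hC q hq) (hψc q' hq') (hψi q' hq')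
  have hint' := integrable_mul_of_growth (hu r hr) (hC r hr) hψc' hi'
  have e : (fun x => u r x * (slope (fun r => ψ r x) s r - ψ' s x)) =
      fun x => ((r - s)⁻¹ : ℝ) • (u r x * ψ r x - u r x * ψ s x) - u r x * ψ' s x := by
    ext x
    rw [slope_def_module, Complex.real_smul, Complex.real_smul]
    ring
  have hi : Integrable (fun x => ((r - s)⁻¹ : ℝ) • (u r x * ψ r x - u r x * ψ s x)) :=
    Integrable.smul ((r - s)⁻¹ : ℝ) ((hint r hr r hr).sub (hint r hr s hs'))
  rw [e, integral_sub hi hint', integral_smul,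
    integral_sub (hint r hr r hr) (hint r hr s hs'), slope_def_module, slope_def_module]
  simp only [Complex.real_smul]
  ring

/-- `ψ r - ψ s` is at most `B |r - s|`, so moving the test function costs `O(|r - s|)` and weak
continuity against the frozen `ψ s` is enough. This serves the endpoint `0`, where the equation
itself is not assumed. -/
theorem continuousWithinAt_integral_mul (hs : s ∈ Icc a b)
    (hu : ∀ r ∈ Icc a b, Continuous (u r))
    (hC : ∀ r ∈ Icc a b, ∀ x, ‖u r x‖ ≤ C * (1 + |x|) ^ N)
    (hψc : ∀ r ∈ Icc a b, Continuous (ψ r))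
    (hψ : ∀ r ∈ Icc a b, ∀ x, HasDerivAt (fun r => ψ r x) (ψ' r x) r)
    (hψi : ∀ r ∈ Icc a b, Integrable (fun x : ℝ => (1 + |x|) ^ N * ‖ψ r x‖))
    (hB : ∀ r ∈ Icc a b, ∀ x, ‖ψ' r x‖ ≤ B x)
    (hBi : Integrable (fun x : ℝ => (1 + |x|) ^ N * B x))
    (hcont : ContinuousWithinAt (fun r => ∫ x, u r x * ψ s x) (Icc a b) s) :
    ContinuousWithinAt (fun r => ∫ x, u r x * ψ r x) (Icc a b) s := by
  have hint : ∀ q ∈ Icc a b, ∀ q' ∈ Icc a b, Integrable (fun x => u q x * ψ q' x) :=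
    fun q hq q' hq' => integrable_mul_of_growth (hu q hq) (hC q hq) (hψc q' hq') (hψi q' hq')
  have hrem : Tendsto (fun r => (∫ x, u r x * ψ r x) - ∫ x, u r x * ψ s x) (𝓝[Icc a b] s)
      (𝓝 0) := by
    have h0 : Tendsto (fun r => (∫ x, C * ((1 + |x|) ^ N * B x)) * ‖r - s‖) (𝓝[Icc a b] s)
        (𝓝 0) := by
      have : Continuous fun r => (∫ x, C * ((1 + |x|) ^ N * B x)) * ‖r - s‖ := by fun_prop
      have := (this.tendsto s).mono_left (nhdsWithin_le_nhds (s := Icc a b))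
      simpa using this
    refine squeeze_zero_norm' ?_ h0
    filter_upwards [self_mem_nhdsWithin] with r hr
    rw [← integral_sub (hint r hr r hr) (hint r hr s hs), ← integral_mul_const]
    refine norm_integral_le_of_norm_le ((hBi.const_mul C).mul_const _)
      (Eventually.of_forall fun x => ?_)
    rw [← mul_sub, norm_mul]
    calc _ ≤ (C * (1 + |x|) ^ N) * (B x * ‖r - s‖) :=
          mul_le_mul (hC r hr x) (norm_sub_le_of_param_deriv_bound hψ hB hs hr x) (norm_nonneg _)
            ((norm_nonneg _).trans (hC r hr x))
      _ = _ := by ring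
  have h := hcont.tendsto.add hrem
  rw [add_zero] at h
  exact h.congr fun r => by ring

end Pairing

/-! ### Fourier representation of weak solutions -/

/-- Duality: along `z r = η + i(t - r)` the kernel satisfies `∂_r ψ = -i ψ''`, which cancels the `i
ψ''` coming from the equation, so the pairing with `u r` is conserved from `r = 0` to `r = t`. -/
theorem integral_mul_heatKernel_eq {u₀ U : ℝ → ℂ} {u : ℝ → ℝ → ℂ} (hU : IsFourierTransform u₀ U)
    (hu : IsFreeSchrodingerSolution u₀ u) {t η : ℝ} (ht : 0 ≤ t) (hη : 0 < η) (y : ℝ) :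
    ∫ x, u t x * heatKernel η y x =
      ∫ p, U p * gaussianExp (η + Complex.I * t) (Complex.I * y) p := by
  -- The horizon exceeds `t` so that `t` is an interior point, where a two-sided derivative can be
  -- taken.
  obtain ⟨C, N, hC⟩ := hu.growth (t + 1)
  let z : ℝ → ℂ := fun r => η + Complex.I * (t - r : ℝ)
  have hzre : ∀ r, (z r).re = η := fun r => by simp [z]
  have hz : ∀ r, 0 < (z r).re := fun r => by rw [hzre]; exact hη
  have hzn : ∀ r ∈ Icc 0 (t + 1), ‖z r‖ ≤ η + (t + 1) := fun r hr => by
    refine (norm_add_le _ _).trans ?_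
    rw [norm_mul, Complex.norm_I, one_mul, Complex.norm_real, Complex.norm_real,
      Real.norm_of_nonneg hη.le, Real.norm_eq_abs]
    gcongr
    rw [abs_le]
    constructor <;> linarith [hr.1, hr.2]
  obtain ⟨K, φ, hb⟩ :=
    exists_deriv_deriv_heatKernel_bound hη (R := η + (t + 1)) (by positivity) y
  let ψ : ℝ → ℝ → ℂ := fun r => heatKernel (z r) y
  let ψ' : ℝ → ℝ → ℂ := fun r x => -Complex.I * deriv (deriv (heatKernel (z r) y)) x
  have hcoe : ∀ r, (heatSchwartz (z r) (hz r) y : ℝ → ℂ) = ψ r := fun r =>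
    funext fun x => heatSchwartz_apply (hz r) y x
  let φ' : ℝ → 𝓢(ℝ, ℂ) := fun r =>
    (-Complex.I) • SchwartzMap.derivCLM ℂ ℂ (SchwartzMap.derivCLM ℂ ℂ (heatSchwartz (z r) (hz r) y))
  have hcoe' : ∀ r, (φ' r : ℝ → ℂ) = ψ' r := fun r => by
    ext x
    have e1 : ((SchwartzMap.derivCLM ℂ ℂ (heatSchwartz (z r) (hz r) y) : 𝓢(ℝ, ℂ)) : ℝ → ℂ) =
        deriv (heatKernel (z r) y) := by
      ext x
      rw [SchwartzMap.derivCLM_apply, hcoe]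
    simp only [φ', ψ', smul_apply, SchwartzMap.derivCLM_apply, e1, smul_eq_mul]
  have hψc : ∀ r ∈ Icc 0 (t + 1), Continuous (ψ r) := fun r _ => by
    rw [← hcoe]; exact SchwartzMap.continuous _
  have hψc' : ∀ r, Continuous (ψ' r) := fun r => by
    rw [← hcoe']; exact SchwartzMap.continuous _
  have hψ : ∀ r ∈ Icc 0 (t + 1), ∀ x, HasDerivAt (fun r => ψ r x) (ψ' r x) r := fun r _ x => by
    have h1 : HasDerivAt z (-Complex.I) r := by
      have : HasDerivAt (fun r : ℝ => ((t - r : ℝ) : ℂ)) ((-1 : ℝ) : ℂ) r :=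
        ((hasDerivAt_id r).const_sub t).ofReal_comp
      exact ((this.const_mul Complex.I).const_add (η : ℂ)).congr_deriv (by simp)
    have := (hasDerivAt_heatKernel_param (hz r) y x).comp r h1
    refine HasDerivAt.congr_deriv (f := fun r => ψ r x) this ?_
    simp only [ψ', deriv_deriv_heatKernel (hz r)]
    ring
  have hψi : ∀ r ∈ Icc 0 (t + 1), Integrable (fun x : ℝ => (1 + |x|) ^ N * ‖ψ r x‖) :=
    fun r _ => by rw [← hcoe]; exact SchwartzMap.integrable_one_add_pow_mul _ N
  have hB : ∀ r ∈ Icc 0 (t + 1), ∀ x, ‖ψ' r x‖ ≤ K * ((1 + |x|) ^ 2 * ‖φ x‖) := fun r hr x => by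
    simp only [ψ', norm_mul, norm_neg, Complex.norm_I, one_mul]
    exact (hb (z r) (hzre r).ge (hzn r hr) x)
  have hBi : Integrable (fun x : ℝ => (1 + |x|) ^ N * (K * ((1 + |x|) ^ 2 * ‖φ x‖))) := by
    refine ((φ.integrable_one_add_pow_mul (N + 2)).const_mul K).congr
      (Eventually.of_forall fun x => ?_)
    simp only [pow_add]
    ring
  have huc : ∀ r ∈ Icc 0 (t + 1), Continuous (u r) := fun r hr => hu.continuous_space r hr.1
  have hderiv : ∀ s ∈ Ioo 0 (t + 1), HasDerivAt (fun r => ∫ x, u r x * ψ r x) 0 s := by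
    intro s hs
    have hD := hu.equation (heatSchwartz (z s) (hz s) y) s hs.1
    have hc := (hu.equation (φ' s) s hs.1).continuousAt
    simp only [hcoe] at hD
    simp only [hcoe'] at hc
    have h := hasDerivAt_integral_mul hs huc hC hψc (hψc' s) hψ hψi hB hBi hD hc
    refine h.congr_deriv ?_
    rw [← integral_const_mul, ← integral_add]
    · simp only [ψ', ψ]
      rw [← integral_zero ℝ ℂ (μ := volume)]
      congr 1 with x
      ring
    · have hi : Integrable (fun x => u s x * ψ' s x) := by
        refine integrable_mul_of_growth (huc s (Ioo_subset_Icc_self hs))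
          (hC s (Ioo_subset_Icc_self hs)) (hψc' s) ?_
        rw [← hcoe']; exact SchwartzMap.integrable_one_add_pow_mul _ N
      refine hi.neg.congr (Eventually.of_forall fun x => ?_)
      simp only [Pi.neg_apply, ψ', ψ]
      ring
    · refine integrable_mul_of_growth (huc s (Ioo_subset_Icc_self hs))
          (hC s (Ioo_subset_Icc_self hs)) (hψc' s) ?_
      rw [← hcoe']; exact SchwartzMap.integrable_one_add_pow_mul _ N
  have h0mem : (0 : ℝ) ∈ Icc 0 (t + 1) := ⟨le_rfl, by linarith⟩
  have hconst : ∫ x, u t x * ψ t x = ∫ x, u 0 x * ψ 0 x := by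
    rcases ht.eq_or_lt with rfl | ht'
    · rfl
    have hmem : ∀ c, 0 < c → c ≤ t → c ∈ Ioo 0 (t + 1) := fun c h1 h2 => ⟨h1, by linarith⟩
    -- The derivative vanishes only at positive times: the pairing is constant on `[c, t]`, and then
    -- `c → 0` by weak continuity at the initial time.
    have hev : ∀ᶠ c in 𝓝[>] (0 : ℝ), ∫ x, u t x * ψ t x = ∫ x, u c x * ψ c x := by
      filter_upwards [Ioo_mem_nhdsGT ht'] with c hc
      refine constant_of_has_deriv_right_zero (f := fun r => ∫ x, u r x * ψ r x) (a := c) (b := t)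
        (fun r hr => (hderiv r (hmem r (hc.1.trans_le hr.1) hr.2)).continuousAt.continuousWithinAt)
        (fun r hr => (hderiv r (hmem r (hc.1.trans_le hr.1) hr.2.le)).hasDerivWithinAt)
        t ⟨hc.2.le, le_rfl⟩
    have hc0 := hu.continuous_initial (heatSchwartz (z 0) (hz 0) y)
    simp only [hcoe] at hc0
    have h := continuousWithinAt_integral_mul h0mem huc hC hψc hψ hψi hB hBi
      (hc0.mono Icc_subset_Ici_self)
    have hlim : Tendsto (fun r => ∫ x, u r x * ψ r x) (𝓝[>] 0) (𝓝 (∫ x, u 0 x * ψ 0 x)) :=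
      h.tendsto.mono_left (nhdsWithin_le_iff.2 (Icc_mem_nhdsGT (by linarith)))
    exact tendsto_nhds_unique (tendsto_const_nhds.congr' hev) hlim
  have hz0 : z 0 = η + Complex.I * t := by simp [z]
  have hzt : z t = η := by simp [z]
  simp only [ψ, hzt] at hconst
  rw [hconst, ← hz0]
  have := hU.2.2 (gaussianSchwartz (z 0) (Complex.I * y) (hz 0))
  simp only [schwartzHat_gaussianSchwartz, gaussianSchwartz_apply] at this
  rw [← this]
  simp only [hu.initial]

/-- The substitution `x = a r + y`. With parameter `a²` the kernel is a rescaled fixed Gaussian, and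
its prefactor `√π / a` meets the Jacobian `a`. -/
theorem integral_mul_heatKernel_sq (v : ℝ → ℂ) (y : ℝ) {a : ℝ} (ha : 0 < a) :
    ∫ x, v x * heatKernel ((a ^ 2 : ℝ) : ℂ) y x =
      √Real.pi * ∫ r : ℝ, v (a * r + y) * gaussianExp (1 / 4 : ℝ) 0 r := by
  rw [← integral_add_right_eq_self _ y]
  have h := Measure.integral_comp_mul_left
    (fun x : ℝ => v (x + y) * heatKernel ((a ^ 2 : ℝ) : ℂ) y (x + y)) a
  rw [abs_of_pos (inv_pos.2 ha), eq_inv_smul_iff₀ ha.ne'] at h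
  rw [← h, Complex.real_smul, ← integral_const_mul, ← integral_const_mul]
  congr 1 with r
  have h1 : ((Real.pi : ℂ) / ((a ^ 2 : ℝ) : ℂ)) ^ (1 / 2 : ℂ) = ((√Real.pi / a : ℝ) : ℂ) := by
    have e : (1 / 2 : ℂ) = ((1 / 2 : ℝ) : ℂ) := by push_cast; rfl
    rw [e, ← Complex.ofReal_div, ← Complex.ofReal_cpow (by positivity), ← Real.sqrt_eq_rpow,
      Real.sqrt_div' _ (by positivity), Real.sqrt_sq ha.le]
  have ha' : (a : ℂ) ≠ 0 := by exact_mod_cast ha.ne'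
  have h2 : -(((a * r + y : ℝ) : ℂ) - y) ^ 2 / (4 * ((a ^ 2 : ℝ) : ℂ)) =
      -((1 / 4 : ℝ) : ℂ) * (r : ℂ) ^ 2 + 0 * r := by
    push_cast
    field_simp
    ring
  rw [heatKernel, h1, gaussianExp, h2]
  push_cast
  field_simp

/-- The heat kernel is an approximate identity on continuous functions of polynomial growth. -/
theorem tendsto_integral_mul_heatKernel {v : ℝ → ℂ} {C : ℝ} {N : ℕ} (hv : Continuous v)
    (hC : ∀ x, ‖v x‖ ≤ C * (1 + |x|) ^ N) (y : ℝ) :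
    Tendsto (fun a : ℝ => ∫ x, v x * heatKernel ((a ^ 2 : ℝ) : ℂ) y x) (𝓝[>] 0)
      (𝓝 (2 * Real.pi * v y)) := by
  have hC0 : 0 ≤ C := by
    have := (norm_nonneg _).trans (hC 0)
    simpa using this
  have hg : ∀ r : ℝ, gaussianExp (1 / 4 : ℝ) 0 r = ((Real.exp (-(1 / 4) * r ^ 2) : ℝ) : ℂ) := by
    intro r; rw [gaussianExp]; push_cast; ring_nf
  have hlim : Tendsto (fun a : ℝ => ∫ r : ℝ, v (a * r + y) * gaussianExp (1 / 4 : ℝ) 0 r)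
      (𝓝[>] 0) (𝓝 (∫ r : ℝ, v (0 * r + y) * gaussianExp (1 / 4 : ℝ) 0 r)) := by
    have hb : 0 < (((1 / 4 : ℝ) : ℂ)).re := by simp
    -- The dominating function for `0 < a < 1`, from `1 + |a r + y| ≤ (1 + |y|)(1 + |r|)`.
    have hi := ((gaussianSchwartz (1 / 4 : ℝ) 0 hb).integrable_one_add_pow_mul N).const_mul
      (C * (1 + |y|) ^ N)
    have hgc : Continuous (gaussianExp (1 / 4 : ℝ) 0) := (contDiff_gaussianExp _ _ 0).continuous
    refine tendsto_integral_filter_of_dominated_convergence _ ?_ ?_ hi ?_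
    · exact Eventually.of_forall fun a => by
        refine Continuous.aestronglyMeasurable ?_
        fun_prop
    · filter_upwards [Ioo_mem_nhdsGT (zero_lt_one' ℝ)] with a ha
      refine Eventually.of_forall fun r => ?_
      rw [norm_mul, ← mul_assoc]
      refine mul_le_mul_of_nonneg_right ((hC _).trans ?_) (norm_nonneg _)
      rw [mul_assoc, ← mul_pow]
      have h1 : |a * r + y| ≤ |r| + |y| := by
        refine (abs_add_le _ _).trans ?_
        rw [abs_mul, abs_of_pos ha.1]
        gcongr
        exact mul_le_of_le_one_left (abs_nonneg r) ha.2.le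
      gcongr
      nlinarith [mul_nonneg (abs_nonneg r) (abs_nonneg y)]
    · refine Eventually.of_forall fun r => ?_
      have : Continuous fun a : ℝ => v (a * r + y) * gaussianExp (1 / 4 : ℝ) 0 r := by fun_prop
      exact (this.tendsto 0).mono_left nhdsWithin_le_nhds
  have h := hlim.const_mul (√Real.pi : ℂ)
  -- The total mass is `√π · √(4π) = 2π`.
  have hval : (√Real.pi : ℂ) * ∫ r : ℝ, v (0 * r + y) * gaussianExp (1 / 4 : ℝ) 0 r =
      2 * Real.pi * v y := by
    simp only [zero_mul, zero_add, hg]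
    rw [integral_const_mul, integral_complex_ofReal, integral_gaussian]
    have e : Real.pi / (1 / 4) = 2 ^ 2 * Real.pi := by ring
    rw [e, Real.sqrt_mul (by norm_num), Real.sqrt_sq (by norm_num)]
    have e2 : (√Real.pi : ℂ) * √Real.pi = Real.pi := by
      rw [← Complex.ofReal_mul, Real.mul_self_sqrt Real.pi_pos.le]
    push_cast
    linear_combination (2 * v y) * e2
  rw [hval] at h
  refine h.congr' ?_
  filter_upwards [self_mem_nhdsWithin] with a ha
  exact (integral_mul_heatKernel_sq v y ha).symm

theorem IsTemperedFunction.integrable_of_support {U : ℝ → ℂ} (hU : IsTemperedFunction U) {a b : ℝ}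
    (h : ∀ p, p ∉ Icc a b → U p = 0) : Integrable U := by
  obtain ⟨N, hN⟩ := hU
  have e : U = fun x : ℝ => (((1 + |x|) ^ N : ℝ) : ℂ) * (((((1 + |x|) ^ N)⁻¹ : ℝ) : ℂ) * U x) := by
    ext x
    have : (1 + |x|) ^ N ≠ 0 := by positivity
    rw [← mul_assoc, ← Complex.ofReal_mul, mul_inv_cancel₀ this, Complex.ofReal_one, one_mul]
  refine (hN.norm.const_mul ((1 + max |a| |b|) ^ N)).mono' ?_ (Eventually.of_forall fun x => ?_)
  · rw [e]
    refine AEStronglyMeasurable.mul (Continuous.aestronglyMeasurable ?_) hN.aestronglyMeasurable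
    fun_prop
  · by_cases hx : x ∈ Icc a b
    · conv_lhs => rw [e]
      rw [norm_mul, Complex.norm_real, Real.norm_of_nonneg (by positivity)]
      gcongr
      exact abs_le_max_abs_abs hx.1 hx.2
    · rw [h x hx, norm_zero]
      positivity

/-- The Fourier representation of a solution whose initial datum has integrable Fourier
transform. -/
theorem two_pi_mul_solution_eq {u₀ U : ℝ → ℂ} {u : ℝ → ℝ → ℂ} (hU : IsFourierTransform u₀ U)
    (hUi : Integrable U) (hu : IsFreeSchrodingerSolution u₀ u) {t : ℝ} (ht : 0 ≤ t) (y : ℝ) :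
    2 * Real.pi * u t y = ∫ p, U p * gaussianExp (Complex.I * t) (Complex.I * y) p := by
  obtain ⟨C, N, hC⟩ := hu.growth t
  have h1 := tendsto_integral_mul_heatKernel (hu.continuous_space t ht)
    (hC t ⟨ht, le_rfl⟩) y
  have h2 : Tendsto (fun a : ℝ => ∫ p, U p *
      gaussianExp ((a ^ 2 : ℝ) + Complex.I * t) (Complex.I * y) p) (𝓝[>] 0)
      (𝓝 (∫ p, U p * gaussianExp (Complex.I * t) (Complex.I * y) p)) := by
    refine tendsto_integral_filter_of_dominated_convergence (fun p => ‖U p‖) ?_ ?_ hUi.norm ?_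
    · exact Eventually.of_forall fun a => hUi.aestronglyMeasurable.mul
        (contDiff_gaussianExp _ _ 0).continuous.aestronglyMeasurable
    · refine Eventually.of_forall fun a => Eventually.of_forall fun p => ?_
      rw [norm_mul, norm_gaussianExp]
      refine mul_le_of_le_one_right (norm_nonneg _) (Real.exp_le_one_iff.2 ?_)
      have : 0 ≤ a ^ 2 * p ^ 2 := by positivity
      simp only [Complex.add_re, Complex.ofReal_re, Complex.mul_re, Complex.I_re, Complex.I_im,
        Complex.ofReal_im]
      linarith
    · refine Eventually.of_forall fun p => ?_
      have hc : Continuous fun a : ℝ => U p *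
          gaussianExp ((a ^ 2 : ℝ) + Complex.I * t) (Complex.I * y) p := by
        unfold gaussianExp; fun_prop
      have := (hc.tendsto 0).mono_left (nhdsWithin_le_nhds (s := Ioi 0))
      simpa using this
  refine tendsto_nhds_unique h1 (h2.congr' ?_)
  filter_upwards [self_mem_nhdsWithin] with a ha
  exact (integral_mul_heatKernel_eq hU hu ht (pow_pos ha 2) y).symm

/-! ### Derivative tests for the quadratic phase -/

/-- The quadratic phase factor `exp (-i t q²)`. -/
def quadPhase (t q : ℝ) : ℂ := Complex.exp (-Complex.I * t * (q : ℂ) ^ 2)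

theorem norm_quadPhase (t q : ℝ) : ‖quadPhase t q‖ = 1 := by
  have : -Complex.I * t * (q : ℂ) ^ 2 = ((-t * q ^ 2 : ℝ) : ℂ) * Complex.I := by
    push_cast; ring
  rw [quadPhase, this, Complex.norm_exp_ofReal_mul_I]

@[fun_prop]
theorem continuous_quadPhase (t : ℝ) : Continuous (quadPhase t) := by
  unfold quadPhase; fun_prop

theorem quadPhase_neg (t q : ℝ) : quadPhase t (-q) = quadPhase t q := by
  simp [quadPhase]

theorem hasDerivAt_quadPhase (t q : ℝ) :
    HasDerivAt (quadPhase t) (-2 * Complex.I * t * q * quadPhase t q) q := by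
  have h1 : HasDerivAt (fun x : ℝ => (x : ℂ)) 1 q := Complex.ofRealCLM.hasDerivAt
  have h := ((h1.pow 2).const_mul (-Complex.I * t)).cexp
  refine HasDerivAt.congr_deriv (f := quadPhase t) h ?_
  simp [quadPhase]
  ring

/-- The first derivative estimate for the quadratic phase, away from its stationary point. -/
theorem norm_integral_quadPhase_le_inv {t A B : ℝ} (ht : 0 < t) (hA : 0 < A) (hAB : A ≤ B) :
    ‖∫ q in A..B, quadPhase t q‖ ≤ 1 / (t * A) := by
  have hpos : ∀ q ∈ uIcc A B, 0 < q := fun q hq => by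
    rw [uIcc_of_le hAB] at hq; exact hA.trans_le hq.1
  have hB : 0 < B := hA.trans_le hAB
  -- Since `quadPhase' = -2itq · quadPhase`, the function `g = c · quadPhase / q` has derivative
  -- `quadPhase - h`: this is integration by parts, with `h` the absolutely integrable remainder.
  let c : ℂ := Complex.I / (2 * t)
  have hc : ‖c‖ = 1 / (2 * t) := by
    simp [c, abs_of_pos ht]
  let g : ℝ → ℂ := fun q => c * (quadPhase t q * (q : ℂ)⁻¹)
  let h : ℝ → ℂ := fun q => c * (quadPhase t q * ((q : ℂ) ^ 2)⁻¹)
  have hg : ∀ q ∈ uIcc A B, HasDerivAt g (quadPhase t q - h q) q := fun q hq => by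
    have hq0 : (q : ℂ) ≠ 0 := by exact_mod_cast (hpos q hq).ne'
    have ht0 : (t : ℂ) ≠ 0 := by exact_mod_cast ht.ne'
    have h1 : HasDerivAt (fun x : ℝ => (x : ℂ)⁻¹) (-((q : ℂ) ^ 2)⁻¹) q :=
      (hasDerivAt_inv hq0).comp_ofReal
    refine HasDerivAt.congr_deriv (f := g) (((hasDerivAt_quadPhase t q).mul h1).const_mul c) ?_
    simp only [c, h]
    field_simp
    linear_combination (-2 * (t : ℂ) * (q : ℂ) ^ 2 * quadPhase t q) * Complex.I_sq
  have hhc : ContinuousOn h (uIcc A B) := by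
    refine continuousOn_const.mul ((continuous_quadPhase t).continuousOn.mul ?_)
    refine ContinuousOn.inv₀ (by fun_prop) fun q hq => ?_
    have hq0 : (q : ℂ) ≠ 0 := by exact_mod_cast (hpos q hq).ne'
    positivity
  have hqi : IntervalIntegrable (quadPhase t) volume A B :=
    (continuous_quadPhase t).intervalIntegrable _ _
  have hint := intervalIntegral.integral_eq_sub_of_hasDerivAt hg (hqi.sub hhc.intervalIntegrable)
  rw [intervalIntegral.integral_sub hqi hhc.intervalIntegrable, sub_eq_iff_eq_add] at hint
  have hgn : ∀ q, 0 < q → ‖g q‖ = 1 / (2 * t) * q⁻¹ := fun q hq => by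
    simp only [g, norm_mul, hc, norm_quadPhase, norm_inv, Complex.norm_real,
      Real.norm_of_nonneg hq.le, one_mul]
  have hreal : ∫ q in A..B, 1 / (2 * t) * (q ^ 2)⁻¹ = 1 / (2 * t) * (A⁻¹ - B⁻¹) := by
    rw [intervalIntegral.integral_const_mul]
    congr 1
    have hd : ∀ q ∈ uIcc A B, HasDerivAt (fun q : ℝ => -q⁻¹) ((q ^ 2)⁻¹) q := fun q hq => by
      exact (hasDerivAt_inv (hpos q hq).ne').neg.congr_deriv (neg_neg _)
    rw [intervalIntegral.integral_eq_sub_of_hasDerivAt hd]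
    · ring
    · refine ContinuousOn.intervalIntegrable (ContinuousOn.inv₀ (by fun_prop) fun q hq => ?_)
      have := hpos q hq
      positivity
  have hhn : ‖∫ q in A..B, h q‖ ≤ 1 / (2 * t) * (A⁻¹ - B⁻¹) := by
    rw [← hreal]
    refine intervalIntegral.norm_integral_le_of_norm_le hAB
      (Eventually.of_forall fun q hq => le_of_eq ?_) ?_
    · have hq0 : 0 < q := hA.trans hq.1
      simp only [h, norm_mul, hc, norm_quadPhase, norm_inv, norm_pow, Complex.norm_real,
        Real.norm_of_nonneg hq0.le, one_mul]
    · refine ContinuousOn.intervalIntegrable (continuousOn_const.mul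
        (ContinuousOn.inv₀ (by fun_prop) fun q hq => ?_))
      have := hpos q hq
      positivity
  rw [hint]
  -- The remainder contributes `A⁻¹ - B⁻¹`, so the `B⁻¹` of the boundary term cancels and the bound
  -- does not depend on `B`.
  calc _ ≤ (‖g B‖ + ‖g A‖) + ‖∫ q in A..B, h q‖ :=
        (norm_add_le _ _).trans (by gcongr; exact norm_sub_le _ _)
    _ ≤ (1 / (2 * t) * B⁻¹ + 1 / (2 * t) * A⁻¹) + 1 / (2 * t) * (A⁻¹ - B⁻¹) := by
        rw [hgn B hB, hgn A hA]; gcongr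
    _ = _ := by field_simp; ring

/-- Cut at `c = t^(-1/2)`, where the trivial bound `c` on the left and the first derivative bound
`1/(tc)` on the right are equal. -/
theorem norm_integral_quadPhase_zero_le {t B : ℝ} (ht : 0 < t) (hB : 0 ≤ B) :
    ‖∫ q in (0 : ℝ)..B, quadPhase t q‖ ≤ 2 * t ^ (-(1 / 2) : ℝ) := by
  set c : ℝ := t ^ (-(1 / 2) : ℝ) with hc
  have hc0 : 0 < c := Real.rpow_pos_of_pos ht _
  have htc : 1 / (t * c) = c := by
    rw [hc, div_eq_iff (by positivity), mul_left_comm, ← Real.rpow_add ht]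
    norm_num
    rw [Real.rpow_neg_one, mul_inv_cancel₀ ht.ne']
  have htriv : ∀ D, 0 ≤ D → ‖∫ q in (0 : ℝ)..D, quadPhase t q‖ ≤ D := fun D hD => by
    have := intervalIntegral.norm_integral_le_of_norm_le_const (a := 0) (b := D) (C := 1)
      (f := quadPhase t) fun q _ => (norm_quadPhase t q).le
    simpa [abs_of_nonneg hD] using this
  rcases le_total B c with h | h
  · linarith [htriv B hB]
  · have hi : ∀ a b : ℝ, IntervalIntegrable (quadPhase t) volume a b :=
      (continuous_quadPhase t).intervalIntegrable
    rw [← intervalIntegral.integral_add_adjacent_intervals (hi 0 c) (hi c B)]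
    have h1 := norm_integral_quadPhase_le_inv ht hc0 h
    rw [htc] at h1
    linarith [norm_add_le (∫ q in (0 : ℝ)..c, quadPhase t q) (∫ q in c..B, quadPhase t q),
      htriv c hc0.le]

/-- The second derivative estimate for the quadratic phase. -/
theorem norm_integral_quadPhase_le_rpow {t : ℝ} (ht : 0 < t) (A B : ℝ) :
    ‖∫ q in A..B, quadPhase t q‖ ≤ 4 * t ^ (-(1 / 2) : ℝ) := by
  have hi : ∀ a b : ℝ, IntervalIntegrable (quadPhase t) volume a b :=
    (continuous_quadPhase t).intervalIntegrable
  have h0 : ∀ B, ‖∫ q in (0 : ℝ)..B, quadPhase t q‖ ≤ 2 * t ^ (-(1 / 2) : ℝ) := fun B => by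
    rcases le_total 0 B with h | h
    · exact norm_integral_quadPhase_zero_le ht h
    · have h1 := norm_integral_quadPhase_zero_le ht (neg_nonneg.2 h)
      have h2 := intervalIntegral.integral_comp_neg (a := 0) (b := B) (quadPhase t)
      simp only [quadPhase_neg, neg_zero] at h2
      rwa [h2, intervalIntegral.integral_symm, norm_neg]
  rw [← intervalIntegral.integral_interval_sub_left (hi 0 B) (hi 0 A)]
  linarith [norm_sub_le (∫ q in (0 : ℝ)..B, quadPhase t q) (∫ q in (0 : ℝ)..A, quadPhase t q),
    h0 A, h0 B]

/-- On `r ≤ d/2` the distance to the stationary point `d` is at least `d/2`; reflecting `r ↦ d - r`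
brings this to the first derivative test. -/
theorem norm_integral_quadPhase_shift_le_inv {t d α s : ℝ} (ht : 0 < t) (hd : 0 < d) (hα : α ≤ s)
    (hs : s ≤ d / 2) : ‖∫ r in α..s, quadPhase t (r - d)‖ ≤ 2 / (t * d) := by
  have h := intervalIntegral.integral_comp_sub_left (a := α) (b := s) (quadPhase t) d
  have e : ∀ r, quadPhase t (d - r) = quadPhase t (r - d) := fun r => by
    rw [← quadPhase_neg, neg_sub]
  simp only [e] at h
  rw [h]
  refine (norm_integral_quadPhase_le_inv ht (by linarith) (by linarith)).trans ?_
  rw [div_le_div_iff₀ (mul_pos ht (by linarith)) (by positivity)]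
  nlinarith

theorem norm_integral_quadPhase_shift_le_rpow {t : ℝ} (ht : 0 < t) (d α s : ℝ) :
    ‖∫ r in α..s, quadPhase t (r - d)‖ ≤ 4 * t ^ (-(1 / 2) : ℝ) := by
  rw [intervalIntegral.integral_comp_sub_right]
  exact norm_integral_quadPhase_le_rpow ht _ _

/-! ### Oscillatory integrals with a singular amplitude -/

section Amplitude

variable {μ L M M' : ℝ} {v v' : ℝ → ℂ}

/-- Integration by parts against the primitive of `f` based at `α`: the cost is `K` times the final
size plus the variation of `s^(μ-1) v(s)`. As `s^(μ-1)` decreases, its variation telescopes, leaving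
only the value at `α`. -/
theorem norm_integral_rpow_mul_le_of_primitive_bound (hμ : μ < 1)
    (hv : ContinuousOn v (Icc 0 L)) (hv' : ContinuousOn v' (Icc 0 L))
    (hd : ∀ s ∈ Ioo 0 L, HasDerivAt v (v' s) s)
    (hM : ∀ s ∈ Icc 0 L, ‖v s‖ ≤ M) (hM' : ∀ s ∈ Icc 0 L, ‖v' s‖ ≤ M')
    {f : ℝ → ℂ} (hf : Continuous f) {α β K : ℝ} (hα : 0 < α) (hαβ : α ≤ β) (hβ : β ≤ L)
    (hK : ∀ s ∈ Icc α β, ‖∫ r in α..s, f r‖ ≤ K) :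
    ‖∫ s in α..β, ((s ^ (μ - 1) : ℝ) : ℂ) * v s * f s‖ ≤ K * ((M + M' * L) * α ^ (μ - 1)) := by
  have hsub : Icc α β ⊆ Icc 0 L := Icc_subset_Icc hα.le hβ
  have hK0 : 0 ≤ K := (norm_nonneg _).trans (hK α ⟨le_rfl, hαβ⟩)
  have hM'0 : 0 ≤ M' := (norm_nonneg _).trans (hM' α ⟨hα.le, hαβ.trans hβ⟩)
  have hrc : ∀ e : ℝ, ContinuousOn (fun s : ℝ => s ^ e) (Icc α β) := fun e s hs =>
    (Real.continuousAt_rpow_const s e (Or.inl (hα.trans_le hs.1).ne')).continuousWithinAt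
  have hrcC : ∀ e : ℝ, ContinuousOn (fun s : ℝ => ((s ^ e : ℝ) : ℂ)) (Icc α β) := fun e =>
    Complex.continuous_ofReal.comp_continuousOn (hrc e)
  let a : ℝ → ℂ := fun s => ((s ^ (μ - 1) : ℝ) : ℂ) * v s
  let a' : ℝ → ℂ := fun s => (((μ - 1) * s ^ (μ - 1 - 1) : ℝ) : ℂ) * v s
    + ((s ^ (μ - 1) : ℝ) : ℂ) * v' s
  have hac : ContinuousOn a (Icc α β) := (hrcC _).mul (hv.mono hsub)
  have ha'c : ContinuousOn a' (Icc α β) := by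
    refine ContinuousOn.add (ContinuousOn.mul ?_ (hv.mono hsub)) ((hrcC _).mul (hv'.mono hsub))
    exact Complex.continuous_ofReal.comp_continuousOn (continuousOn_const.mul (hrc _))
  have had : ∀ s ∈ Ioo α β, HasDerivAt a (a' s) s := fun s hs => by
    have hs0 : 0 < s := hα.trans hs.1
    exact (Real.hasDerivAt_rpow_const (Or.inl hs0.ne')).ofReal_comp.mul
      (hd s ⟨hs0, hs.2.trans_le hβ⟩)
  let E : ℝ → ℂ := fun s => ∫ r in α..s, f r
  have hEd : ∀ s, HasDerivAt E (f s) s := fun s =>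
    intervalIntegral.integral_hasDerivAt_right (hf.intervalIntegrable _ _)
      (hf.stronglyMeasurableAtFilter _ _) hf.continuousAt
  have hEc : Continuous E := continuous_iff_continuousAt.2 fun s => (hEd s).continuousAt
  have hparts := intervalIntegral.integral_mul_deriv_eq_deriv_mul_of_hasDerivAt (a := α) (b := β)
    (u := a) (v := E) (u' := a') (v' := f) (by rwa [uIcc_of_le hαβ]) hEc.continuousOn
    (by rw [min_eq_left hαβ, max_eq_right hαβ]; exact had) (fun s _ => hEd s)
    (ContinuousOn.intervalIntegrable (by rwa [uIcc_of_le hαβ])) (hf.intervalIntegrable _ _)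
  have hE0 : E α = 0 := intervalIntegral.integral_same
  rw [hE0, mul_zero, sub_zero] at hparts
  have hβ0 : 0 < β := hα.trans_le hαβ
  have h1 : ‖a β * E β‖ ≤ M * β ^ (μ - 1) * K := by
    rw [norm_mul]
    refine mul_le_mul ?_ (hK β ⟨hαβ, le_rfl⟩) (norm_nonneg _) ?_
    · rw [norm_mul, Complex.norm_real, Real.norm_of_nonneg (by positivity), mul_comm]
      gcongr
      exact hM β ⟨hβ0.le, hβ⟩
    · exact mul_nonneg ((norm_nonneg _).trans (hM β ⟨hβ0.le, hβ⟩)) (by positivity)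
  have hreal : ∫ s in α..β, (((1 - μ) * s ^ (μ - 1 - 1)) * M + α ^ (μ - 1) * M') * K =
      ((α ^ (μ - 1) - β ^ (μ - 1)) * M + (β - α) * (α ^ (μ - 1) * M')) * K := by
    have hi : IntervalIntegrable (fun s : ℝ => (1 - μ) * s ^ (μ - 1 - 1)) volume α β :=
      ContinuousOn.intervalIntegrable (by
        rw [uIcc_of_le hαβ]; exact continuousOn_const.mul (hrc _))
    rw [intervalIntegral.integral_mul_const, intervalIntegral.integral_add (hi.mul_const _)
      intervalIntegrable_const, intervalIntegral.integral_mul_const,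
      intervalIntegral.integral_const, smul_eq_mul]
    congr 3
    rw [intervalIntegral.integral_eq_sub_of_hasDerivAt (f := fun s => -s ^ (μ - 1)) _ hi]
    · ring
    · intro s hs
      rw [uIcc_of_le hαβ] at hs
      exact (Real.hasDerivAt_rpow_const (Or.inl (hα.trans_le hs.1).ne')).neg.congr_deriv (by ring)
  have h2 : ‖∫ s in α..β, a' s * E s‖ ≤
      ((α ^ (μ - 1) - β ^ (μ - 1)) * M + (β - α) * (α ^ (μ - 1) * M')) * K := by
    rw [← hreal]
    refine intervalIntegral.norm_integral_le_of_norm_le hαβ (Eventually.of_forall fun s hs => ?_) ?_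
    · have hs' : s ∈ Icc α β := Ioc_subset_Icc_self hs
      have hs0 : 0 < s := hα.trans hs.1
      rw [norm_mul]
      refine mul_le_mul ?_ (hK s hs') (norm_nonneg _) ?_
      · refine (norm_add_le _ _).trans ?_
        rw [norm_mul, norm_mul, Complex.norm_real, Complex.norm_real, norm_mul,
          Real.norm_of_nonpos (by linarith : μ - 1 ≤ 0),
          Real.norm_of_nonneg (by positivity : 0 ≤ s ^ (μ - 1 - 1)),
          Real.norm_of_nonneg (by positivity : 0 ≤ s ^ (μ - 1)), neg_sub]
        have h3 : s ^ (μ - 1) ≤ α ^ (μ - 1) :=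
          Real.rpow_le_rpow_of_nonpos hα hs.1.le (by linarith)
        have h4 : 0 ≤ 1 - μ := by linarith
        have := hM s (hsub hs')
        have := hM' s (hsub hs')
        gcongr
      · have := (norm_nonneg _).trans (hM s (hsub hs'))
        have h4 : 0 ≤ 1 - μ := by linarith
        positivity
    · refine ContinuousOn.intervalIntegrable ?_
      rw [uIcc_of_le hαβ]
      exact (((continuousOn_const.mul (hrc _)).mul continuousOn_const).add
        continuousOn_const).mul continuousOn_const
  have hgoal : ∫ s in α..β, ((s ^ (μ - 1) : ℝ) : ℂ) * v s * f s = ∫ s in α..β, a s * f s := rfl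
  rw [hgoal, hparts]
  -- The boundary term `M β^(μ-1)` cancels against the variation of the power.
  calc _ ≤ M * β ^ (μ - 1) * K +
        ((α ^ (μ - 1) - β ^ (μ - 1)) * M + (β - α) * (α ^ (μ - 1) * M')) * K :=
        (norm_sub_le _ _).trans (add_le_add h1 h2)
    _ = K * ((M + M' * (β - α)) * α ^ (μ - 1)) := by ring
    _ ≤ _ := by gcongr; linarith

theorem intervalIntegrable_rpow_mul (hμ : 0 < μ) (hv : ContinuousOn v (Icc 0 L)) {f : ℝ → ℂ}
    (hf : Continuous f) {α β : ℝ} (hα : 0 ≤ α) (hαβ : α ≤ β) (hβ : β ≤ L) :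
    IntervalIntegrable (fun s => ((s ^ (μ - 1) : ℝ) : ℂ) * v s * f s) volume α β := by
  have h0 : IntervalIntegrable (fun s : ℝ => s ^ (μ - 1)) volume α β :=
    intervalIntegral.intervalIntegrable_rpow' (by linarith)
  have h1 : IntervalIntegrable (fun s : ℝ => ((s ^ (μ - 1) : ℝ) : ℂ)) volume α β :=
    ⟨h0.1.ofReal, h0.2.ofReal⟩
  refine (h1.mul_continuousOn ?_).mul_continuousOn hf.continuousOn
  rw [uIcc_of_le hαβ]
  exact hv.mono (Icc_subset_Icc hα hβ)

theorem norm_integral_zero_rpow_mul_le (hμ : 0 < μ) (hM : ∀ s ∈ Icc 0 L, ‖v s‖ ≤ M)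
    {f : ℝ → ℂ} (hf : ∀ s, ‖f s‖ ≤ 1) {β : ℝ} (h0 : 0 ≤ β) (hβ : β ≤ L) :
    ‖∫ s in (0 : ℝ)..β, ((s ^ (μ - 1) : ℝ) : ℂ) * v s * f s‖ ≤ M / μ * β ^ μ := by
  have hreal : ∫ s in (0 : ℝ)..β, M * s ^ (μ - 1) = M / μ * β ^ μ := by
    rw [intervalIntegral.integral_const_mul, integral_rpow (Or.inl (by linarith)), sub_add_cancel,
      Real.zero_rpow hμ.ne']
    ring
  rw [← hreal]
  refine intervalIntegral.norm_integral_le_of_norm_le h0 (Eventually.of_forall fun s hs => ?_)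
    ((intervalIntegral.intervalIntegrable_rpow' (by linarith)).const_mul _)
  have hs' : s ∈ Icc 0 L := ⟨hs.1.le, hs.2.trans hβ⟩
  have hr : 0 ≤ s ^ (μ - 1) := Real.rpow_nonneg hs.1.le _
  rw [norm_mul, norm_mul, Complex.norm_real, Real.norm_of_nonneg hr]
  calc _ ≤ s ^ (μ - 1) * ‖v s‖ * 1 := by gcongr; exact hf s
    _ ≤ s ^ (μ - 1) * M * 1 := by gcongr; exact hM s hs'
    _ = _ := by ring

/-- The oscillatory integral with quadratic phase, stationary point `d` and singular amplitude
`s ^ (μ - 1) v(s)`: the two terms are the contributions of `d` and of the singularity. -/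
theorem norm_integral_rpow_mul_quadPhase_le (hμ : μ ∈ Ioo (0 : ℝ) 1)
    (hv : ContinuousOn v (Icc 0 L)) (hv' : ContinuousOn v' (Icc 0 L))
    (hd : ∀ s ∈ Ioo 0 L, HasDerivAt v (v' s) s)
    (hM : ∀ s ∈ Icc 0 L, ‖v s‖ ≤ M) (hM' : ∀ s ∈ Icc 0 L, ‖v' s‖ ≤ M')
    {t d : ℝ} (ht : 0 < t) (hd0 : 0 < d) (hdL : d ≤ L) (htd : 1 ≤ t * d ^ 2) :
    ‖∫ s in (0 : ℝ)..L, ((s ^ (μ - 1) : ℝ) : ℂ) * v s * quadPhase t (s - d)‖ ≤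
      (M / μ + 8 * (M + M' * L)) * (t ^ (-(1 / 2) : ℝ) * d ^ (μ - 1) + (t * d) ^ (-μ)) := by
  obtain ⟨hμ0, hμ1⟩ := hμ
  have hL : 0 ≤ L := hd0.le.trans hdL
  have hM0 : 0 ≤ M := (norm_nonneg _).trans (hM 0 ⟨le_rfl, hL⟩)
  have hM'0 : 0 ≤ M' := (norm_nonneg _).trans (hM' 0 ⟨le_rfl, hL⟩)
  set Q := M + M' * L with hQ
  have hQ0 : 0 ≤ Q := by positivity
  have hf : Continuous fun s => quadPhase t (s - d) := by fun_prop
  have htd0 : 0 < t * d := mul_pos ht hd0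
  -- The scale at which the trivial bound `η^μ` and the first derivative bound `η^(μ-1)/(td)` are
  -- both of order `(td)^(-μ)`. The ordering `η ≤ d/2` is exactly `1 ≤ t d²`.
  set η := (2 * (t * d))⁻¹ with hη
  have hη0 : 0 < η := by positivity
  have hηd : η ≤ d / 2 := by
    rw [hη, inv_le_iff_one_le_mul₀ (by positivity)]
    nlinarith
  have hi := fun {α β : ℝ} => intervalIntegrable_rpow_mul (α := α) (β := β) hμ0 hv hf
  rw [← intervalIntegral.integral_add_adjacent_intervals
      (hi le_rfl (by linarith) (by linarith) : IntervalIntegrable _ volume 0 (d / 2))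
      (hi (by linarith) (by linarith) le_rfl),
    ← intervalIntegral.integral_add_adjacent_intervals
      (hi le_rfl hη0.le (by linarith) : IntervalIntegrable _ volume 0 η)
      (hi hη0.le hηd (by linarith))]
  have h2pow : (2 : ℝ) ^ (1 - μ) ≤ 2 := by
    calc (2 : ℝ) ^ (1 - μ) ≤ 2 ^ (1 : ℝ) :=
          Real.rpow_le_rpow_of_exponent_le (by norm_num) (by linarith)
      _ = 2 := Real.rpow_one 2
  have h1 : ‖∫ s in (0 : ℝ)..η, ((s ^ (μ - 1) : ℝ) : ℂ) * v s * quadPhase t (s - d)‖ ≤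
      M / μ * (t * d) ^ (-μ) := by
    refine (norm_integral_zero_rpow_mul_le hμ0 hM (fun s => (norm_quadPhase t _).le) hη0.le
      (by linarith)).trans ?_
    gcongr
    rw [hη, Real.inv_rpow (by positivity), ← Real.rpow_neg (by positivity)]
    exact Real.rpow_le_rpow_of_nonpos htd0 (by linarith) (by linarith)
  have h2 : ‖∫ s in η..d / 2, ((s ^ (μ - 1) : ℝ) : ℂ) * v s * quadPhase t (s - d)‖ ≤
      4 * Q * (t * d) ^ (-μ) := by
    refine (norm_integral_rpow_mul_le_of_primitive_bound hμ1 hv hv' hd hM hM' hf hη0 hηd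
      (by linarith) fun s hs =>
        norm_integral_quadPhase_shift_le_inv ht hd0 hs.1 hs.2).trans ?_
    have e : η ^ (μ - 1) = 2 ^ (1 - μ) * ((t * d) * (t * d) ^ (-μ)) := by
      rw [hη, Real.inv_rpow (by positivity), ← Real.rpow_neg (by positivity), neg_sub,
        Real.mul_rpow (by norm_num) htd0.le, sub_eq_add_neg, Real.rpow_add htd0, Real.rpow_one]
    rw [e]
    calc _ = 2 * Q * (t * d) ^ (-μ) * 2 ^ (1 - μ) := by rw [← hQ]; field_simp
      _ ≤ 2 * Q * (t * d) ^ (-μ) * 2 := by gcongr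
      _ = _ := by ring
  -- This piece contains the stationary point; the bound on the primitive is `4 t^(-1/2)`, and the
  -- power is largest at the left end `d/2`.
  have h3 : ‖∫ s in d / 2..L, ((s ^ (μ - 1) : ℝ) : ℂ) * v s * quadPhase t (s - d)‖ ≤
      8 * Q * (t ^ (-(1 / 2) : ℝ) * d ^ (μ - 1)) := by
    refine (norm_integral_rpow_mul_le_of_primitive_bound hμ1 hv hv' hd hM hM' hf (by linarith)
      (by linarith) le_rfl fun s hs =>
        norm_integral_quadPhase_shift_le_rpow ht d _ s).trans ?_
    have e : (d / 2) ^ (μ - 1) = 2 ^ (1 - μ) * d ^ (μ - 1) := by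
      rw [Real.div_rpow hd0.le (by norm_num), div_eq_mul_inv, ← Real.rpow_neg (by norm_num),
        neg_sub, mul_comm]
    rw [e]
    calc _ = 4 * Q * (t ^ (-(1 / 2) : ℝ) * d ^ (μ - 1)) * 2 ^ (1 - μ) := by ring
      _ ≤ 4 * Q * (t ^ (-(1 / 2) : ℝ) * d ^ (μ - 1)) * 2 := by gcongr
      _ = _ := by ring
  set X := t ^ (-(1 / 2) : ℝ) * d ^ (μ - 1)
  set Y := (t * d) ^ (-μ)
  have hX : 0 ≤ X := by positivity
  have hY : 0 ≤ Y := by positivity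
  have hMμ : 0 ≤ M / μ := by positivity
  refine (norm_add₃_le.trans (add_le_add (add_le_add h1 h2) h3)).trans ?_
  nlinarith [mul_nonneg hMμ hX, mul_nonneg hQ0 hY]

end Amplitude

/-! ### Decay of band-limited solutions -/

theorem gaussianExp_I_mul_eq {t : ℝ} (ht : t ≠ 0) (x p : ℝ) :
    gaussianExp (Complex.I * t) (Complex.I * x) p =
      Complex.exp ((x ^ 2 / (4 * t) : ℝ) * Complex.I) * quadPhase t (p - x / (2 * t)) := by
  have : (t : ℂ) ≠ 0 := by exact_mod_cast ht
  rw [gaussianExp, quadPhase, ← Complex.exp_add]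
  congr 1
  push_cast
  field_simp
  ring

/-- A solution with Fourier datum supported in `[p₁, p₂]` and given there by
`(p - p₁) ^ (μ - 1) ũ(p)` is, up to a constant, an oscillatory integral with quadratic phase. -/
theorem two_pi_mul_norm_solution_eq {p₁ p₂ μ : ℝ} (hp : p₁ ≤ p₂) {u₀ U ũ : ℝ → ℂ}
    {u : ℝ → ℝ → ℂ} (hU : IsFourierTransform u₀ U) (hsupp : ∀ p, p ∉ Icc p₁ p₂ → U p = 0)
    (hform : ∀ p ∈ Ioc p₁ p₂, U p = (((p - p₁) ^ (μ - 1) : ℝ) : ℂ) * ũ p)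
    (hu : IsFreeSchrodingerSolution u₀ u) {t : ℝ} (ht : 0 < t) (x : ℝ) :
    2 * Real.pi * ‖u t x‖ = ‖∫ s in (0 : ℝ)..(p₂ - p₁), ((s ^ (μ - 1) : ℝ) : ℂ) * ũ (s + p₁) *
      quadPhase t (s - (x / (2 * t) - p₁))‖ := by
  have h1 := two_pi_mul_solution_eq hU (hU.2.1.integrable_of_support hsupp) hu ht.le x
  have h2 : ∫ p, U p * gaussianExp (Complex.I * t) (Complex.I * x) p =
      ∫ p in p₁..p₂, U p * gaussianExp (Complex.I * t) (Complex.I * x) p := by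
    rw [intervalIntegral.integral_of_le hp, ← integral_Icc_eq_integral_Ioc]
    refine (setIntegral_eq_integral_of_forall_compl_eq_zero fun p hpn => ?_).symm
    rw [hsupp p hpn, zero_mul]
  have h3 : ∫ p in p₁..p₂, U p * gaussianExp (Complex.I * t) (Complex.I * x) p =
      ∫ p in p₁..p₂, Complex.exp ((x ^ 2 / (4 * t) : ℝ) * Complex.I) *
        ((((p - p₁) ^ (μ - 1) : ℝ) : ℂ) * ũ p * quadPhase t (p - x / (2 * t))) := by
    refine intervalIntegral.integral_congr_ae (Eventually.of_forall fun p hpm => ?_)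
    -- The half-open interval omits `p₁`, where no formula for `U` is given.
    rw [uIoc_of_le hp] at hpm
    rw [hform p hpm, gaussianExp_I_mul_eq ht.ne']
    ring
  have h4 := intervalIntegral.integral_comp_add_right (a := 0) (b := p₂ - p₁)
    (fun p => (((p - p₁) ^ (μ - 1) : ℝ) : ℂ) * ũ p * quadPhase t (p - x / (2 * t))) p₁
  rw [zero_add, sub_add_cancel] at h4
  rw [h2, h3, intervalIntegral.integral_const_mul, ← h4] at h1
  have h5 := congrArg norm h1
  rw [norm_mul (2 * Real.pi : ℂ), norm_mul (Complex.exp _), Complex.norm_exp_ofReal_mul_I,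
    one_mul] at h5
  have h6 : ‖(2 * Real.pi : ℂ)‖ = 2 * Real.pi := by
    rw [norm_mul, Complex.norm_real, Real.norm_of_nonneg Real.pi_pos.le]
    norm_num
  rw [h6] at h5
  rw [h5]
  congr 2 with s
  rw [add_sub_cancel_right]
  congr 2
  ring

/-- The decay estimate for a band-limited solution with a singular frequency at `p₁`, in terms of
the distance of `x / 2t` to `p₁`. -/
theorem exists_solution_bound {p₁ p₂ μ : ℝ} (hp : p₁ < p₂) (hμ : μ ∈ Ioo (0 : ℝ) 1) {u₀ : ℝ → ℂ}
    (hu₀ : SingularBandCondition p₁ p₂ μ u₀) :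
    ∃ K : ℝ, 0 < K ∧ ∀ u : ℝ → ℝ → ℂ, IsFreeSchrodingerSolution u₀ u → ∀ t x : ℝ, 0 < t →
      ‖u t x‖ ≤ K ∧ (p₁ < x / (2 * t) → x / (2 * t) ≤ p₂ → 1 ≤ t * (x / (2 * t) - p₁) ^ 2 →
        ‖u t x‖ ≤ K * (t ^ (-(1 / 2) : ℝ) * (x / (2 * t) - p₁) ^ (μ - 1) +
          (t * (x / (2 * t) - p₁)) ^ (-μ))) := by
  obtain ⟨U, ũ, hU, hsupp, hũ, -, hform, -⟩ := hu₀
  have hmap : MapsTo (fun s => s + p₁) (Icc 0 (p₂ - p₁)) (Icc p₁ p₂) := fun s hs =>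
    ⟨by linarith [hs.1], by linarith [hs.2]⟩
  let v : ℝ → ℂ := fun s => ũ (s + p₁)
  -- The one-sided derivative is continuous up to both endpoints, hence bounded on the closed
  -- interval; it is a genuine derivative inside.
  let v' : ℝ → ℂ := fun s => derivWithin ũ (Icc p₁ p₂) (s + p₁)
  have hv : ContinuousOn v (Icc 0 (p₂ - p₁)) := hũ.continuousOn.comp (by fun_prop) hmap
  have hv' : ContinuousOn v' (Icc 0 (p₂ - p₁)) :=
    (hũ.continuousOn_derivWithin (uniqueDiffOn_Icc hp) le_rfl).comp (by fun_prop) hmap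
  have hd : ∀ s ∈ Ioo 0 (p₂ - p₁), HasDerivAt v (v' s) s := fun s hs => by
    have h1 : s + p₁ ∈ Ioo p₁ p₂ := ⟨by linarith [hs.1], by linarith [hs.2]⟩
    have h2 := ((hũ.differentiableOn one_ne_zero) (s + p₁)
      (Ioo_subset_Icc_self h1)).hasDerivWithinAt.hasDerivAt (Icc_mem_nhds h1.1 h1.2)
    exact h2.comp_add_const s p₁
  obtain ⟨M, hM⟩ := isCompact_Icc.exists_bound_of_continuousOn hv
  obtain ⟨M', hM'⟩ := isCompact_Icc.exists_bound_of_continuousOn hv'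
  set L := p₂ - p₁ with hL
  have hL0 : 0 < L := sub_pos.2 hp
  have hM0 : 0 ≤ M := (norm_nonneg _).trans (hM 0 ⟨le_rfl, hL0.le⟩)
  have hM'0 : 0 ≤ M' := (norm_nonneg _).trans (hM' 0 ⟨le_rfl, hL0.le⟩)
  have hμ0 := hμ.1
  -- The bound from absolute values, uniform in `t` and `x`; it covers small times.
  set K₁ := M / μ * L ^ μ
  set K₂ := M / μ + 8 * (M + M' * L)
  have hK₁ : 0 ≤ K₁ := by positivity
  have hK₂ : 0 ≤ K₂ := by positivity
  have hpi : 1 ≤ 2 * Real.pi := by linarith [Real.pi_gt_three]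
  refine ⟨K₁ + K₂ + 1, by positivity, fun u hu t x ht => ?_⟩
  have hrep := two_pi_mul_norm_solution_eq hp.le hU hsupp hform hu ht x
  have hle : ‖u t x‖ ≤ ‖∫ s in (0 : ℝ)..L, ((s ^ (μ - 1) : ℝ) : ℂ) * v s *
      quadPhase t (s - (x / (2 * t) - p₁))‖ := by
    refine le_trans ?_ hrep.le
    exact le_mul_of_one_le_left (norm_nonneg _) hpi
  constructor
  · refine hle.trans ((norm_integral_zero_rpow_mul_le hμ0 hM
      (fun s => (norm_quadPhase t _).le) hL0.le le_rfl).trans ?_)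
    linarith
  · intro h1 h2 h3
    refine hle.trans ((norm_integral_rpow_mul_quadPhase_le hμ hv hv' hd hM hM' ht (sub_pos.2 h1)
      (sub_le_sub_right h2 _) h3).trans ?_)
    have : 0 < x / (2 * t) - p₁ := sub_pos.2 h1
    exact mul_le_mul_of_nonneg_right (by linarith) (by positivity)

/-- Both powers of `d` are negative, so the worst case is `d = t^(-ε)`. -/
theorem rpow_mul_add_rpow_le {μ ε t d : ℝ} (hμ : μ ∈ Ioo (0 : ℝ) 1) (ht : 1 ≤ t)
    (hd : t ^ (-ε) ≤ d) :
    t ^ (-(1 / 2) : ℝ) * d ^ (μ - 1) + (t * d) ^ (-μ) ≤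
      t ^ (-(1 / 2) + ε * (1 - μ)) + t ^ (-μ + ε * μ) := by
  have ht0 : 0 < t := one_pos.trans_le ht
  have hp : 0 < t ^ (-ε) := Real.rpow_pos_of_pos ht0 _
  have hd0 : 0 < d := hp.trans_le hd
  have h1 : d ^ (μ - 1) ≤ t ^ (ε * (1 - μ)) := by
    refine (Real.rpow_le_rpow_of_nonpos hp hd (by linarith [hμ.2])).trans_eq ?_
    rw [← Real.rpow_mul ht0.le]
    ring_nf
  have h2 : d ^ (-μ) ≤ t ^ (ε * μ) := by
    refine (Real.rpow_le_rpow_of_nonpos hp hd (by linarith [hμ.1])).trans_eq ?_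
    rw [← Real.rpow_mul ht0.le]
    ring_nf
  rw [Real.mul_rpow ht0.le hd0.le, Real.rpow_add ht0, Real.rpow_add ht0]
  gcongr

end

theorem theorem3p2 (p₁ p₂ μ : ℝ) (hp : p₁ < p₂) (hμ : μ ∈ Ioo (0 : ℝ) 1)
    (u₀ : ℝ → ℂ) (hu₀ : SingularBandCondition p₁ p₂ μ u₀)
    (δ : ℝ) (hδ : δ ∈ Ico ((μ + 1) / 2) 1) (ε : ℝ) (hε : ε ∈ Ioo 0 (δ - 1 / 2)) :
    ∃ C₁ C₂ C₃ : ℝ, 0 < C₁ ∧ 0 < C₂ ∧ 0 < C₃ ∧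
      ∀ u : ℝ → ℝ → ℂ, IsFreeSchrodingerSolution u₀ u →
        ∀ t x : ℝ, (t, x) ∈ regionR ε p₁ p₂ →
          (1 / 2 < μ → ‖u t x‖ ≤ C₁ * t ^ (-(1 / 2) + ε * (1 - μ))) ∧
          (μ = 1 / 2 → ‖u t x‖ ≤ C₂ * t ^ (-(1 / 2) + ε / 2)) ∧
          (μ < 1 / 2 → ‖u t x‖ ≤ C₃ * t ^ (-μ + ε * μ)) := by
  obtain ⟨K, hK, hbound⟩ := exists_solution_bound hp hμ hu₀
  have hε0 : 0 < ε := hε.1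
  -- The role of `δ < 1`: it gives `1 - 2ε > 0`, used both to compare the two exponents and to
  -- ensure `t d² ≥ 1`.
  have hε1 : ε < 1 / 2 := by linarith [hε.2, hδ.2]
  obtain ⟨hμ0, hμ1⟩ := hμ
  -- All three cases follow from one bound with any nonpositive `e` dominating both exponents; at `μ
  -- = 1/2` the two coincide.
  suffices key : ∀ u : ℝ → ℝ → ℂ, IsFreeSchrodingerSolution u₀ u →
      ∀ t x : ℝ, (t, x) ∈ regionR ε p₁ p₂ → ∀ e : ℝ, e ≤ 0 → -(1 / 2) + ε * (1 - μ) ≤ e →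
        -μ + ε * μ ≤ e → ‖u t x‖ ≤ 2 * K * t ^ e by
    refine ⟨2 * K, 2 * K, 2 * K, by positivity, by positivity, by positivity,
      fun u hu t x htx => ⟨fun h => ?_, fun h => ?_, fun h => ?_⟩⟩
    · exact key u hu t x htx _ (by nlinarith) le_rfl (by nlinarith)
    · subst h
      exact key u hu t x htx _ (by linarith) (by linarith) (by linarith)
    · exact key u hu t x htx _ (by nlinarith) (by nlinarith) le_rfl
  intro u hu t x htx e he he1 he2
  obtain ⟨h1, h2, h3⟩ := htx
  dsimp only at h1 h2 h3
  have hL : 0 < 2 * (p₂ - p₁) := by linarith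
  have ht : 0 < t := (Real.rpow_pos_of_pos hL _).trans h3
  have hte : 0 < t ^ e := Real.rpow_pos_of_pos ht _
  obtain ⟨hb1, hb2⟩ := hbound u hu t x ht
  -- The threshold time may lie below `1`. For `t ≤ 1` one has `t^e ≥ 1`, so the uniform bound is
  -- enough.
  rcases le_total t 1 with h | h
  · have : 1 ≤ t ^ e := Real.one_le_rpow_of_pos_of_le_one_of_nonpos ht h he
    nlinarith
  · have hp0 : 0 < t ^ (-ε) := Real.rpow_pos_of_pos ht _
    have hd0 := hp0.trans_le h1
    have hx : x / (2 * t) ≤ p₂ := by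
      rw [div_le_iff₀ (by positivity)]; linarith
    -- On the region `t d² ≥ t^(1-2ε) ≥ 1`, so the cut near the singularity stays to the left of
    -- `d/2`.
    have htd : 1 ≤ t * (x / (2 * t) - p₁) ^ 2 := by
      calc (1 : ℝ) ≤ t ^ (1 + -ε * 2) := Real.one_le_rpow h (by linarith)
        _ = t * (t ^ (-ε)) ^ 2 := by
          rw [Real.rpow_add ht, Real.rpow_one, Real.rpow_mul ht.le, Real.rpow_two]
        _ ≤ _ := by gcongr
    have hle1 := Real.rpow_le_rpow_of_exponent_le h he1
    have hle2 := Real.rpow_le_rpow_of_exponent_le h he2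
    have hle := rpow_mul_add_rpow_le ⟨hμ0, hμ1⟩ h h1
    calc ‖u t x‖ ≤ K * _ := hb2 (by linarith) hx htd
      _ ≤ K * (t ^ e + t ^ e) := mul_le_mul_of_nonneg_left (by linarith) hK.le
      _ = _ := by ring
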